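/- Consider numbers $u=x+\alpha y+\beta z+\gamma t$ ($x,y,z,t\in\mathbb R$) with modulus $|u|=(x^2+y^2+z^2+t^2)^{1/2}$ and one of the following four commutative, associative products. - Circular: $\alpha^2=-1,\ \beta^2=-1,\ \gamma^2=1,\ \alpha\beta=-\gamma,\ \alpha\gamma=\beta,\ \beta\gamma=\alpha$; nodal hyperplanes $\{x+t=0,\ y+z=0\}$ and $\{x-t=0,\ y-z=0\}$. - Hyperbolic: $\alpha^2=\beta^2=\gamma^2=1,\ \alpha\beta=\gamma,\ \alpha\gamma=\beta,\ \beta\gamma=\alpha$; nodal hyperplanes $x+y+z+t=0$, $x-y+z-t=0$, $x+y-z-t=0$, $x-y-z+t=0$. - Planar: $\alpha^2=\beta,\ \beta^2=-1,\ \gamma^2=-\beta,\ \alpha\beta=\gamma,\ \alpha\gamma=-1,\ \beta\gamma=-\alpha$; nodal hyperplanes $\{x+\frac{y-t}{\sqrt2}=0,\ z+\frac{y+t}{\sqrt2}=0\}$ and $\{x-\frac{y-t}{\sqrt2}=0,\ z-\frac{y+t}{\sqrt2}=0\}$. - Polar: $\alpha^2=\beta,\ \beta^2=1,\ \gamma^2=\beta,\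 \alpha\beta=\gamma,\ \alpha\gamma=1,\ \beta\gamma=\alpha$; nodal hyperplanes $x+y+z+t=0$, $x-y+z-t=0$ and $\{x=z,\ y=t\}$. A function $f$ is analytic at $u_0$ if at every point $u_1$ of some neighbourhood of $u_0$ it has a derivative, that is, a number $f'(u_1)$ of the system with $|f(u)-f(u_1)-f'(u_1)(u-u_1)|=o(|u-u_1|)$ as $u\to u_1$. The hyperplanes associated with a set $J$ of singular points are the hyperplanes which pass through some $u_0\in J$ and are parallel to a nodal hyperplane. An oriented surface lying in a set $\Sigma$ is given by finitely many oriented continuous (singular) triangles in $\Sigma$ with integer multiplicities; it spans the loop $\Gamma$ if its boundary, in the sense of singular chains, is $\Gamma$. Let $f$ be a function of a fourcomplex variable in any one of the four systems, let $D$ and $J$ be sets of fourcomplex numbers, and suppose that $f$ is analytic at every point of $D$ which lies on none of the hyperplanes associated with $J$. Let $\Sigma\subseteq D$ be a set that is not intersected by any of the hyperplanes associated with $J$. 1. If $\Gamma$ is a piecewise continuously differentiable closed loop spanned by an oriented surface lying in $\Sigma$, then the integral of $f(u)\,du$ (fourcomplex product) along $\Gamma$ exists and $\oint_\Gamma f(u)\,du=0$.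 2. If $\Gamma_1,\Gamma_2$ are piecewise continuously differentiable paths from $A$ to $B$ such that the loop consisting of $\Gamma_1$ followed by the reverse of $\Gamma_2$ is spanned by an oriented surface lying in $\Sigma$, then the integrals along both paths exist and $\int_{\Gamma_1}f(u)\,du=\int_{\Gamma_2}f(u)\,du$. -/

import Mathlib

noncomputable section

open scoped Topology unitInterval
open Asymptotics

/-- The four systems of commutative hypercomplex numbers `x + α y + β z + γ t`. -/
inductive FourSystem
  | circular
  | hyperbolic
  | planar
  | polar

/-- The fourcomplex numbers of the system `s`: the real vector space of quadruples `(x, y, z, t)`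
with the modulus `|u| = (x² + y² + z² + t²)^(1/2)`. Only the product depends on `s`. -/
def Fourcomplex (_s : FourSystem) : Type := EuclideanSpace ℝ (Fin 4)

namespace Fourcomplex

instance (s : FourSystem) : NormedAddCommGroup (Fourcomplex s) :=
  inferInstanceAs (NormedAddCommGroup (EuclideanSpace ℝ (Fin 4)))

instance (s : FourSystem) : NormedSpace ℝ (Fourcomplex s) :=
  inferInstanceAs (NormedSpace ℝ (EuclideanSpace ℝ (Fin 4)))

instance (s : FourSystem) : FiniteDimensional ℝ (Fourcomplex s) :=
  inferInstanceAs (FiniteDimensional ℝ (EuclideanSpace ℝ (Fin 4)))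

variable {s : FourSystem}

/-- The number `x + α y + β z + γ t`. -/
def mk (s : FourSystem) (x y z t : ℝ) : Fourcomplex s := WithLp.toLp 2 ![x, y, z, t]

/-- The components of a fourcomplex number. -/
def coord (u : Fourcomplex s) (i : Fin 4) : ℝ :=
  (WithLp.ofLp (p := 2) (V := Fin 4 → ℝ) u) i

/-- The component `x` of `x + α y + β z + γ t`. -/
def x (u : Fourcomplex s) : ℝ := u.coord 0

/-- The component `y` of `x + α y + β z + γ t`. -/
def y (u : Fourcomplex s) : ℝ := u.coord 1

/-- The component `z` of `x + α y + β z + γ t`. -/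
def z (u : Fourcomplex s) : ℝ := u.coord 2

/-- The component `t` of `x + α y + β z + γ t`. -/
def t (u : Fourcomplex s) : ℝ := u.coord 3

@[ext] theorem ext {u v : Fourcomplex s} (hx : u.x = v.x) (hy : u.y = v.y) (hz : u.z = v.z)
    (ht : u.t = v.t) : u = v := by
  apply WithLp.ofLp_injective (p := 2) (V := Fin 4 → ℝ)
  funext i
  fin_cases i
  · exact hx
  · exact hy
  · exact hz
  · exact ht

@[simp] theorem x_mk (a b c d : ℝ) : (mk s a b c d).x = a := rfl
@[simp] theorem y_mk (a b c d : ℝ) : (mk s a b c d).y = b := rfl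
@[simp] theorem z_mk (a b c d : ℝ) : (mk s a b c d).z = c := rfl
@[simp] theorem t_mk (a b c d : ℝ) : (mk s a b c d).t = d := rfl
@[simp] theorem x_add (u v : Fourcomplex s) : (u + v).x = u.x + v.x := rfl
@[simp] theorem y_add (u v : Fourcomplex s) : (u + v).y = u.y + v.y := rfl
@[simp] theorem z_add (u v : Fourcomplex s) : (u + v).z = u.z + v.z := rfl
@[simp] theorem t_add (u v : Fourcomplex s) : (u + v).t = u.t + v.t := rfl
@[simp] theorem x_sub (u v : Fourcomplex s) : (u - v).x = u.x - v.x := rfl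
@[simp] theorem y_sub (u v : Fourcomplex s) : (u - v).y = u.y - v.y := rfl
@[simp] theorem z_sub (u v : Fourcomplex s) : (u - v).z = u.z - v.z := rfl
@[simp] theorem t_sub (u v : Fourcomplex s) : (u - v).t = u.t - v.t := rfl
@[simp] theorem x_zero : (0 : Fourcomplex s).x = 0 := rfl
@[simp] theorem y_zero : (0 : Fourcomplex s).y = 0 := rfl
@[simp] theorem z_zero : (0 : Fourcomplex s).z = 0 := rfl
@[simp] theorem t_zero : (0 : Fourcomplex s).t = 0 := rfl
@[simp] theorem x_smul (r : ℝ) (u : Fourcomplex s) : (r • u).x = r * u.x := rfl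
@[simp] theorem y_smul (r : ℝ) (u : Fourcomplex s) : (r • u).y = r * u.y := rfl
@[simp] theorem z_smul (r : ℝ) (u : Fourcomplex s) : (r • u).z = r * u.z := rfl
@[simp] theorem t_smul (r : ℝ) (u : Fourcomplex s) : (r • u).t = r * u.t := rfl

/-- The product of the system:
* circular: `α² = -1, β² = -1, γ² = 1, αβ = -γ, αγ = β, βγ = α`;
* hyperbolic: `α² = 1, β² = 1, γ² = 1, αβ = γ, αγ = β, βγ = α`;
* planar: `α² = β, β² = -1, γ² = -β, αβ = γ, αγ = -1, βγ = -α`;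
* polar: `α² = β, β² = 1, γ² = β, αβ = γ, αγ = 1, βγ = α`. -/
def mul : (s : FourSystem) → Fourcomplex s → Fourcomplex s → Fourcomplex s
  | .circular, u, v => mk _
      (u.x * v.x - u.y * v.y - u.z * v.z + u.t * v.t)
      (u.x * v.y + u.y * v.x + u.z * v.t + u.t * v.z)
      (u.x * v.z + u.z * v.x + u.y * v.t + u.t * v.y)
      (u.x * v.t + u.t * v.x - u.y * v.z - u.z * v.y)
  | .hyperbolic, u, v => mk _
      (u.x * v.x + u.y * v.y + u.z * v.z + u.t * v.t)
      (u.x * v.y + u.y * v.x + u.z * v.t + u.t * v.z)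
      (u.x * v.z + u.z * v.x + u.y * v.t + u.t * v.y)
      (u.x * v.t + u.t * v.x + u.y * v.z + u.z * v.y)
  | .planar, u, v => mk _
      (u.x * v.x - u.y * v.t - u.z * v.z - u.t * v.y)
      (u.x * v.y + u.y * v.x - u.z * v.t - u.t * v.z)
      (u.x * v.z + u.y * v.y + u.z * v.x - u.t * v.t)
      (u.x * v.t + u.y * v.z + u.z * v.y + u.t * v.x)
  | .polar, u, v => mk _
      (u.x * v.x + u.y * v.t + u.z * v.z + u.t * v.y)
      (u.x * v.y + u.y * v.x + u.z * v.t + u.t * v.z)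
      (u.x * v.z + u.y * v.y + u.z * v.x + u.t * v.t)
      (u.x * v.t + u.y * v.z + u.z * v.y + u.t * v.x)

theorem mul_comm_aux (u v : Fourcomplex s) : mul s u v = mul s v u := by
  cases s <;> ext <;> simp [mul] <;> ring

theorem mul_assoc_aux (u v w : Fourcomplex s) :
    mul s (mul s u v) w = mul s u (mul s v w) := by
  cases s <;> ext <;> simp [mul] <;> ring

theorem mul_add_aux (u v w : Fourcomplex s) :
    mul s u (v + w) = mul s u v + mul s u w := by
  cases s <;> ext <;> simp [mul] <;> ring

theorem one_mul_aux (u : Fourcomplex s) : mul s (mk s 1 0 0 0) u = u := by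
  cases s <;> ext <;> simp [mul]

theorem zero_mul_aux (u : Fourcomplex s) : mul s 0 u = 0 := by
  cases s <;> ext <;> simp [mul]

theorem smul_mul_aux (r : ℝ) (u v : Fourcomplex s) : mul s (r • u) v = r • mul s u v := by
  cases s <;> ext <;> simp [mul] <;> ring

instance (s : FourSystem) : CommRing (Fourcomplex s) :=
  { (inferInstance : AddCommGroup (Fourcomplex s)) with
    mul := mul s
    one := mk s 1 0 0 0
    mul_assoc := mul_assoc_aux
    mul_comm := mul_comm_aux
    one_mul := one_mul_aux
    mul_one := fun u => (mul_comm_aux u (mk s 1 0 0 0)).trans (one_mul_aux u)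
    zero_mul := zero_mul_aux
    mul_zero := fun u => (mul_comm_aux u 0).trans (zero_mul_aux u)
    left_distrib := mul_add_aux
    right_distrib := fun u v w => by
      change mul s (u + v) w = mul s u w + mul s v w
      rw [mul_comm_aux (u + v), mul_add_aux, mul_comm_aux w u, mul_comm_aux w v] }

theorem mul_def (u v : Fourcomplex s) : u * v = mul s u v := rfl

instance (s : FourSystem) : Algebra ℝ (Fourcomplex s) :=
  Algebra.ofModule smul_mul_aux (fun r u v => by
    rw [mul_comm u, mul_comm u]
    exact smul_mul_aux r v u)

/-- The union of the nodal hyperplanes of the system (through the origin). -/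
def nodal : (s : FourSystem) → Set (Fourcomplex s)
  | .circular => {u | (u.x + u.t = 0 ∧ u.y + u.z = 0) ∨ (u.x - u.t = 0 ∧ u.y - u.z = 0)}
  | .hyperbolic => {u | u.x + u.y + u.z + u.t = 0 ∨ u.x - u.y + u.z - u.t = 0 ∨
      u.x + u.y - u.z - u.t = 0 ∨ u.x - u.y - u.z + u.t = 0}
  | .planar => {u |
      (u.x + (u.y - u.t) / √2 = 0 ∧ u.z + (u.y + u.t) / √2 = 0) ∨
      (u.x - (u.y - u.t) / √2 = 0 ∧ u.z - (u.y + u.t) / √2 = 0)}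
  | .polar => {u | u.x + u.y + u.z + u.t = 0 ∨ u.x - u.y + u.z - u.t = 0 ∨
      (u.x = u.z ∧ u.y = u.t)}

/-- The union of the hyperplanes associated with the singular points `u₀ ∈ J`: those which pass
through `u₀` and are parallel to the nodal hyperplanes. -/
def singularHyperplanes (J : Set (Fourcomplex s)) : Set (Fourcomplex s) :=
  {u | ∃ u₀ ∈ J, u - u₀ ∈ nodal s}

/-- The number `f'` is the derivative of `f` at `u₀`: the remainder `f(u) - f(u₀) - f' (u - u₀)`, with the
product of the system `s`, is `o(|u - u₀|)`, whatever the direction of approach. -/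
def HasFourDerivAt (f : Fourcomplex s → Fourcomplex s) (f' u₀ : Fourcomplex s) : Prop :=
  (fun u => f u - f u₀ - f' * (u - u₀)) =o[𝓝 u₀] fun u => u - u₀

/-- `f` is analytic at `u₀`: it has a fourcomplex derivative at every point near `u₀`. -/
def IsAnalyticAt (f : Fourcomplex s → Fourcomplex s) (u₀ : Fourcomplex s) : Prop :=
  ∀ᶠ u in 𝓝 u₀, ∃ f' : Fourcomplex s, HasFourDerivAt f f' u

/-- The differential form `f(u) du`: it sends a tangent vector `v` at `u` to the product
`f(u) v`. -/
def form (f : Fourcomplex s → Fourcomplex s) (u : Fourcomplex s) :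
    Fourcomplex s →L[ℝ] Fourcomplex s :=
  LinearMap.toContinuousLinearMap (LinearMap.mulLeft ℝ (f u))

end Fourcomplex

/-- A piecewise continuously differentiable path. -/
def PiecewiseC1 {E : Type*} [NormedAddCommGroup E] [NormedSpace ℝ E] {a b : E}
    (p : Path a b) : Prop :=
  ∃ (n : ℕ) (part : ℕ → ℝ), Monotone part ∧ part 0 = 0 ∧ part n = 1 ∧
    ∀ i < n, ContDiffOn ℝ 1 p.extend (Set.Icc (part i) (part (i + 1)))

/-- The edge of the standard triangle that runs from the vertex `i` to the vertex `j`. -/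
def triangleEdge (i j : Fin 3) : C(I, stdSimplex ℝ (Fin 3)) where
  toFun r := ⟨(1 - (r : ℝ)) • Pi.single i 1 + (r : ℝ) • Pi.single j 1,
    convex_stdSimplex ℝ (Fin 3) (single_mem_stdSimplex ℝ i) (single_mem_stdSimplex ℝ j)
      (sub_nonneg.2 r.2.2) r.2.1 (sub_add_cancel 1 (r : ℝ))⟩
  continuous_toFun := by fun_prop

/-- The boundary of a formal integer combination of continuous triangles: each oriented triangle
`T` with vertices `0, 1, 2` contributes `[1,2] - [0,2] + [0,1]`. -/
def triangleBoundary {X : Type*} [TopologicalSpace X]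
    (c : C(stdSimplex ℝ (Fin 3), X) →₀ ℤ) : C(I, X) →₀ ℤ :=
  c.sum fun T n =>
    n • (Finsupp.single (T.comp (triangleEdge 1 2)) 1 - Finsupp.single (T.comp (triangleEdge 0 2)) 1
      + Finsupp.single (T.comp (triangleEdge 0 1)) 1)

/-- `S` carries an oriented surface which spans the closed loop `Γ`: finitely many oriented
continuous triangles in `S`, whose edges cancel except for `Γ`. -/
def Spans {X : Type*} [TopologicalSpace X] {a : X} (S : Set X) (Γ : Path a a) : Prop :=
  ∃ c : C(stdSimplex ℝ (Fin 3), X) →₀ ℤ,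
    (∀ T ∈ c.support, Set.range T ⊆ S) ∧
      triangleBoundary c = Finsupp.single Γ.toContinuousMap 1

end

/-!
The fourcomplex product is bilinear, commutative and associative. So if `f` is analytic on the open
set `U`, the 1-form `f(u) du` is differentiable there with derivative `(v, w) ↦ f'(u) v w`, which is
symmetric: the form is closed (`Fourcomplex.isClosedFormOn_form`). Nothing else about the four
systems matters, and the singular hyperplanes enter only through the fact that the surface lies in
the set of points of analyticity. The derivative need not be continuous; the Poincaré lemma of
Mathlib still gives primitives on balls in `U`, namely integrals along segments from a base point.

The triangles that make up the surface are only continuous, so the form cannot be pulled back to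
them. Instead, a continuous path `p` gets the polygonal sums `polygonalSum ω n p`, the integrals of
`ω` over the segments from `p (k / n)` to `p ((k + 1) / n)`. They make sense for all continuous
paths, extend linearly to chains, and have two properties.

* For a continuous map of a square into `U`, uniform continuity puts the image of each cell of a
  fine grid into a ball contained in `U`, where segment integrals are additive. Telescoping over
  the grid gives an exact discrete Stokes formula for large `n`
  (`IsClosedFormOn.eventually_polygonalSum_square`). A triangle is a square with a collapsed side,
  so the polygonal sums vanish on the boundary of every chain of triangles in `U` once `n` is large
  (`IsClosedFormOn.eventually_polygonalSum_triangleBoundary`).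
* For a piecewise continuously differentiable path in `U` and large `n`, the polygonal sum equals
  the curve integral, by the fundamental theorem of calculus for the local primitives
  (`IsClosedFormOn.eventually_polygonalSum_eq_curveIntegral`).

A loop that is the boundary of a chain therefore has integral zero. Independence of the path is
this statement for the loop `p.trans q.symm`.
-/

open Set Filter Topology MeasureTheory unitInterval

/-! ### Subdivisions -/

/-- A continuous map from a compact space into an open set `U` is, at a uniform scale, a map into
balls contained in `U`. -/
theorem ContinuousMap.exists_forall_mapsTo_ball {X Y : Type*} [PseudoMetricSpace X]
    [CompactSpace X] [PseudoMetricSpace Y] {U : Set Y} (g : C(X, Y)) (hU : IsOpen U)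
    (hg : range g ⊆ U) :
    ∃ δ > 0, ∀ p : X, ∃ (c : Y) (r : ℝ), Metric.ball c r ⊆ U ∧
      ∀ q, dist q p < δ → g q ∈ Metric.ball c r := by
  choose r hr hrU using fun p : X => Metric.isOpen_iff.1 hU (g p) (hg (mem_range_self p))
  obtain ⟨δ, hδ, h⟩ := lebesgue_number_lemma_of_metric (s := (univ : Set X))
    (c := fun p => g ⁻¹' Metric.ball (g p) (r p)) isCompact_univ
    (fun p => Metric.isOpen_ball.preimage g.continuous)
    (fun p _ => mem_iUnion.2 ⟨p, Metric.mem_ball_self (hr p)⟩)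
  refine ⟨δ, hδ, fun p => ?_⟩
  obtain ⟨i, hi⟩ := h p (mem_univ p)
  exact ⟨g i, r i, hrU i, fun q hq => hi hq⟩

/-- The point `k / n` of the unit interval, for `k ≤ n` and `n ≠ 0`. -/
noncomputable def gridPoint (n k : ℕ) : I := projIcc 0 1 zero_le_one ((k : ℝ) / n)

@[simp] theorem gridPoint_zero (n : ℕ) : gridPoint n 0 = 0 := by
  simp [gridPoint]

theorem gridPoint_self {n : ℕ} (hn : n ≠ 0) : gridPoint n n = 1 := by
  have : (n : ℝ) ≠ 0 := by exact_mod_cast hn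
  simp [gridPoint, div_self this]

theorem dist_gridPoint_succ_le (n k : ℕ) : dist (gridPoint n (k + 1)) (gridPoint n k) ≤ 1 / n := by
  have h := abs_projIcc_sub_projIcc (a := (0 : ℝ)) (b := 1) (c := ((k + 1 : ℕ) : ℝ) / n)
    (d := (k : ℝ) / n) zero_le_one
  rw [Subtype.dist_eq, Real.dist_eq]
  refine h.trans (le_of_eq ?_)
  rw [← sub_div, Nat.cast_succ, add_sub_cancel_left, abs_of_nonneg (by positivity)]

/-! ### Closed 1-forms -/

section ClosedForm

variable {E F : Type*} [NormedAddCommGroup E] [NormedSpace ℝ E] [NormedAddCommGroup F]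
  [NormedSpace ℝ F] {ω : E → E →L[ℝ] F} {U V : Set E}

/-- The 1-form `ω` is closed on `U`: at each point of `U` it is differentiable, with symmetric
derivative. Continuity of the derivative is not required. -/
def IsClosedFormOn (ω : E → E →L[ℝ] F) (U : Set E) : Prop :=
  ∀ u ∈ U, DifferentiableAt ℝ ω u ∧ ∀ v w, fderiv ℝ ω u v w = fderiv ℝ ω u w v

theorem IsClosedFormOn.mono (h : IsClosedFormOn ω U) (hV : V ⊆ U) : IsClosedFormOn ω V :=
  fun u hu => h u (hV hu)

theorem IsClosedFormOn.continuousOn (h : IsClosedFormOn ω U) : ContinuousOn ω U :=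
  fun u hu => (h u hu).1.continuousAt.continuousWithinAt

/-- The cocycle relation by which the two ways around a cell of a grid have equal sums. -/
theorem IsClosedFormOn.segment_add (h : IsClosedFormOn ω U) (hU : Convex ℝ U) {a b c : E}
    (ha : a ∈ U) (hb : b ∈ U) (hc : c ∈ U) :
    curveIntegral ω (.segment a b) + curveIntegral ω (.segment b c) =
      curveIntegral ω (.segment a c) :=
  hU.curveIntegral_segment_add_eq_of_hasFDerivWithinAt_symmetric
    (fun u hu => (h u hu).1.hasFDerivAt.hasFDerivWithinAt)
    (fun u hu v _ w _ => (h u hu).2 v w) ha hb hc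

theorem IsClosedFormOn.hasFDerivAt_segment [CompleteSpace F] (h : IsClosedFormOn ω U)
    (hU : Convex ℝ U) (hUo : IsOpen U) {a b : E} (ha : a ∈ U) (hb : b ∈ U) :
    HasFDerivAt (fun x => curveIntegral ω (.segment a x)) (ω b) b :=
  (hU.hasFDerivWithinAt_curveIntegral_segment_of_hasFDerivWithinAt_symmetric
    (fun u hu => (h u hu).1.hasFDerivAt.hasFDerivWithinAt)
    (fun u hu v _ w _ => (h u hu).2 v w) ha hb).hasFDerivAt (hUo.mem_nhds hb)

theorem curveIntegral_segment_self (ω : E → E →L[ℝ] F) (a : E) :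
    curveIntegral ω (.segment a a) = 0 := by
  simp

/-! ### Polygonal sums and the discrete Stokes theorem -/

/-- The integral of `ω` along the polygon inscribed in `p` with vertices `p (k / n)`. -/
noncomputable def polygonalSum (ω : E → E →L[ℝ] F) (n : ℕ) (p : C(I, E)) : F :=
  ∑ k ∈ Finset.range n,
    curveIntegral ω (.segment (p (gridPoint n k)) (p (gridPoint n (k + 1))))

/-- Discrete Stokes theorem on a square: around each cell of a fine grid the four segment integrals
cancel, because the cell is mapped into a ball on which `ω` has a primitive. -/
theorem IsClosedFormOn.eventually_polygonalSum_square (h : IsClosedFormOn ω U) (hU : IsOpen U)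
    (H : C(I × I, E)) (hH : range H ⊆ U) :
    ∀ᶠ n in atTop,
      polygonalSum ω n (H.comp (.prodMk (.id I) (.const I 0))) +
          polygonalSum ω n (H.comp (.prodMk (.const I 1) (.id I))) =
        polygonalSum ω n (H.comp (.prodMk (.const I 0) (.id I))) +
          polygonalSum ω n (H.comp (.prodMk (.id I) (.const I 1))) := by
  obtain ⟨δ, hδ, hball⟩ := H.exists_forall_mapsTo_ball hU hH
  filter_upwards [tendsto_one_div_atTop_nhds_zero_nat.eventually_lt_const hδ, eventually_gt_atTop 0]
    with n hn hn0
  set P : ℕ → ℕ → E := fun i j => H (gridPoint n i, gridPoint n j) with hP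
  set w : E → E → F := fun a b => curveIntegral ω (.segment a b) with hw
  have cell (i j : ℕ) : w (P i j) (P (i + 1) j) + w (P (i + 1) j) (P (i + 1) (j + 1)) =
      w (P i j) (P i (j + 1)) + w (P i (j + 1)) (P (i + 1) (j + 1)) := by
    obtain ⟨c, r, hcr, hq⟩ := hball (gridPoint n i, gridPoint n j)
    have hi := (dist_gridPoint_succ_le n i).trans_lt hn
    have hj := (dist_gridPoint_succ_le n j).trans_lt hn
    have h00 : P i j ∈ Metric.ball c r := hq _ (by simpa using hδ)
    have h10 : P (i + 1) j ∈ Metric.ball c r := hq _ (max_lt hi (by simpa using hδ))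
    have h01 : P i (j + 1) ∈ Metric.ball c r := hq _ (max_lt (by simpa using hδ) hj)
    have h11 : P (i + 1) (j + 1) ∈ Metric.ball c r :=
      hq _ (max_lt hi hj)
    have hω := h.mono hcr
    have hc := convex_ball c r
    rw [hw]
    rw [hω.segment_add hc h00 h10 h11, hω.segment_add hc h00 h01 h11]
  -- telescope over the cells of a row, then over the rows
  have row (i : ℕ) : ∑ j ∈ Finset.range n, w (P (i + 1) j) (P (i + 1) (j + 1)) -
      ∑ j ∈ Finset.range n, w (P i j) (P i (j + 1)) =
        w (P i n) (P (i + 1) n) - w (P i 0) (P (i + 1) 0) := by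
    rw [← Finset.sum_sub_distrib, ← Finset.sum_range_sub (fun j => w (P i j) (P (i + 1) j))]
    refine Finset.sum_congr rfl fun j _ => ?_
    rw [sub_eq_sub_iff_add_eq_add, add_comm, cell, add_comm]
  have total := Finset.sum_range_sub (fun i => ∑ j ∈ Finset.range n, w (P i j) (P i (j + 1))) n
  rw [Finset.sum_congr rfl (fun i _ => row i), Finset.sum_sub_distrib] at total
  have h1 : gridPoint n n = 1 := gridPoint_self hn0.ne'
  simp only [hP, h1, gridPoint_zero] at total
  rw [sub_eq_sub_iff_add_eq_add] at total
  exact (add_comm _ _).trans (total.symm.trans (add_comm _ _))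

/-- The square that parametrizes the standard triangle by the segments from the vertex `0` to the
points of the opposite edge. -/
noncomputable def squareToTriangle : C(I × I, stdSimplex ℝ (Fin 3)) where
  toFun q := ⟨(1 - (q.1 : ℝ)) • Pi.single 0 1 + (q.1 : ℝ) • (triangleEdge 1 2 q.2 : Fin 3 → ℝ),
    convex_stdSimplex ℝ (Fin 3) (single_mem_stdSimplex ℝ 0) (triangleEdge 1 2 q.2).2
      (sub_nonneg.2 q.1.2.2) q.1.2.1 (sub_add_cancel 1 (q.1 : ℝ))⟩
  continuous_toFun := by fun_prop

/-- The discrete Stokes theorem on a triangle, parametrized by a square one side of which is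
collapsed to the vertex `0`. -/
theorem IsClosedFormOn.eventually_polygonalSum_triangle (h : IsClosedFormOn ω U) (hU : IsOpen U)
    (T : C(stdSimplex ℝ (Fin 3), E)) (hT : range T ⊆ U) :
    ∀ᶠ n in atTop, polygonalSum ω n (T.comp (triangleEdge 1 2)) -
      polygonalSum ω n (T.comp (triangleEdge 0 2)) +
        polygonalSum ω n (T.comp (triangleEdge 0 1)) = 0 := by
  filter_upwards [h.eventually_polygonalSum_square hU (T.comp squareToTriangle)
    ((range_comp_subset_range squareToTriangle T).trans hT)] with n hn
  have e01 : (T.comp squareToTriangle).comp (.prodMk (.id I) (.const I 0)) =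
      T.comp (triangleEdge 0 1) := by
    ext r
    refine congrArg T (Subtype.ext ?_)
    simp [squareToTriangle, triangleEdge]
  have e02 : (T.comp squareToTriangle).comp (.prodMk (.id I) (.const I 1)) =
      T.comp (triangleEdge 0 2) := by
    ext r
    refine congrArg T (Subtype.ext ?_)
    simp [squareToTriangle, triangleEdge]
  have e12 : (T.comp squareToTriangle).comp (.prodMk (.const I 1) (.id I)) =
      T.comp (triangleEdge 1 2) := by
    ext r
    refine congrArg T (Subtype.ext ?_)
    simp [squareToTriangle]
    rfl
  have e00 : polygonalSum ω n ((T.comp squareToTriangle).comp (.prodMk (.const I 0) (.id I))) =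
      0 := by
    refine Finset.sum_eq_zero fun k _ => ?_
    have hc (r : I) : (T.comp squareToTriangle).comp (.prodMk (.const I 0) (.id I)) r =
        T ⟨Pi.single 0 1, single_mem_stdSimplex ℝ 0⟩ := by
      refine congrArg T (Subtype.ext ?_)
      simp [squareToTriangle]
    rw [hc, hc, curveIntegral_segment_self]
  rw [e01, e02, e12, e00, zero_add] at hn
  rw [← hn]
  abel

/-- The polygonal sums, extended linearly to chains of paths, eventually vanish on the boundary of a
chain: a chain has finitely many triangles, so one mesh is fine enough for all of them. -/
theorem IsClosedFormOn.eventually_polygonalSum_triangleBoundary (h : IsClosedFormOn ω U)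
    (hU : IsOpen U) (c : C(stdSimplex ℝ (Fin 3), E) →₀ ℤ) (hc : ∀ T ∈ c.support, range T ⊆ U) :
    ∀ᶠ n in atTop, Finsupp.linearCombination ℤ (polygonalSum ω n) (triangleBoundary c) = 0 := by
  filter_upwards [(eventually_all_finset c.support).2 fun T hT =>
    h.eventually_polygonalSum_triangle hU T (hc T hT)] with n hn
  rw [triangleBoundary, Finsupp.sum, map_sum]
  refine Finset.sum_eq_zero fun T hT => ?_
  rw [map_smul, map_add, map_sub]
  simp only [Finsupp.linearCombination_single, one_smul]
  rw [hn T hT, smul_zero]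

end ClosedForm

/-! ### Integrals along piecewise continuously differentiable paths -/

section PiecewisePath

variable {E F : Type*} [NormedAddCommGroup E] [NormedSpace ℝ E] [NormedAddCommGroup F]
  [NormedSpace ℝ F] {ω : E → E →L[ℝ] F} {U : Set E} {a b c : E} {p : Path a b} {q : Path b c}

theorem exists_lt_mem_Ico_succ {part : ℕ → ℝ} {n : ℕ} {t : ℝ} (h0 : part 0 ≤ t)
    (hn : t < part n) : ∃ i < n, t ∈ Ico (part i) (part (i + 1)) := by
  classical
  have hex : ∃ j, t < part j := ⟨n, hn⟩
  obtain ⟨i, hi⟩ : ∃ i, Nat.find hex = i + 1 :=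
    Nat.exists_eq_succ_of_ne_zero fun h => (Nat.find_spec hex).not_ge (h ▸ h0)
  refine ⟨i, ?_, not_lt.1 (Nat.find_min hex (by omega)), hi ▸ Nat.find_spec hex⟩
  have := Nat.find_min' hex hn
  omega

theorem PiecewiseC1.exists_finite_differentiableAt (hp : PiecewiseC1 p) :
    ∃ s : Set ℝ, s.Finite ∧ ∀ t ∈ Ioo (0 : ℝ) 1 \ s, DifferentiableAt ℝ p.extend t := by
  obtain ⟨n, part, -, h0, h1, hC⟩ := hp
  refine ⟨part '' Iio n, (finite_Iio n).image part, fun t ⟨ht, hts⟩ => ?_⟩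
  obtain ⟨i, hi, hti⟩ := exists_lt_mem_Ico_succ (part := part) (n := n)
    (h0 ▸ ht.1.le) (h1 ▸ ht.2)
  have hne : part i ≠ t := fun h => hts ⟨i, hi, h⟩
  have hnhds := Icc_mem_nhds (hti.1.lt_of_ne hne) hti.2
  exact ((hC i hi).contDiffAt hnhds).differentiableAt one_ne_zero

/-- On each piece the integrand agrees, off the two breakpoints, with a function that is continuous
on the closed piece. -/
theorem PiecewiseC1.curveIntegrable (hp : PiecewiseC1 p) (hω : ContinuousOn ω U)
    (hpU : range p ⊆ U) : CurveIntegrable ω p := by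
  obtain ⟨n, part, hmono, h0, h1, hC⟩ := hp
  have key : IntervalIntegrable (curveIntegralFun ω p) volume (part 0) (part n) := by
    refine IntervalIntegrable.trans_iterate fun i hi => ?_
    rcases (hmono i.le_succ).eq_or_lt with h | h
    · rw [Nat.succ_eq_add_one] at h
      rw [h]
    have hcont : ContinuousOn (fun t => ω (p.extend t)
        (derivWithin p.extend (Icc (part i) (part (i + 1))) t)) (Icc (part i) (part (i + 1))) := by
      refine ContinuousOn.clm_apply (hω.comp (by fun_prop) fun t _ => hpU ?_)
        ((hC i hi).continuousOn_derivWithin (uniqueDiffOn_Icc h) le_rfl)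
      rw [← p.extend_range]
      exact mem_range_self t
    refine (hcont.intervalIntegrable_of_Icc h.le).congr_ae ?_
    rw [uIoc_of_le h.le, ← restrict_Ioo_eq_restrict_Ioc]
    filter_upwards [ae_restrict_mem measurableSet_Ioo] with t ht
    have h0i : 0 ≤ part i := h0 ▸ hmono i.zero_le
    have h1i : part (i + 1) ≤ 1 := h1 ▸ hmono hi
    rw [curveIntegralFun_def, derivWithin_of_mem_nhds (Icc_mem_nhds ht.1 ht.2),
      derivWithin_of_mem_nhds (Icc_mem_nhds (h0i.trans_lt ht.1) (ht.2.trans_le h1i))]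
  rwa [h0, h1] at key

/-- The inscribed polygons of a piecewise continuously differentiable path eventually give the
exact value of the integral: each of their sides and the corresponding arc have the same end points
and lie in a ball on which the form has a primitive. -/
theorem IsClosedFormOn.eventually_polygonalSum_eq_curveIntegral [CompleteSpace F]
    (h : IsClosedFormOn ω U) (hU : IsOpen U) (hp : PiecewiseC1 p) (hpU : range p ⊆ U) :
    ∀ᶠ n in atTop, polygonalSum ω n p.toContinuousMap = curveIntegral ω p := by
  have hint := hp.curveIntegrable h.continuousOn hpU
  obtain ⟨s, hs, hdiff⟩ := hp.exists_finite_differentiableAt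
  obtain ⟨δ, hδ, hball⟩ := p.toContinuousMap.exists_forall_mapsTo_ball hU hpU
  filter_upwards [tendsto_one_div_atTop_nhds_zero_nat.eventually_lt_const hδ, eventually_gt_atTop 0]
    with n hn hn0
  have hnR : (0 : ℝ) < n := by exact_mod_cast hn0
  have hle (k : ℕ) : (k : ℝ) / n ≤ ((k + 1 : ℕ) : ℝ) / n := by gcongr; simp
  have hk1 {k : ℕ} (hk : k < n) : ((k + 1 : ℕ) : ℝ) / n ≤ 1 :=
    (div_le_one hnR).2 (by exact_mod_cast hk)
  have hk0 (k : ℕ) : 0 ≤ (k : ℝ) / n := by positivity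
  have hint' (k : ℕ) (hk : k < n) : IntervalIntegrable (curveIntegralFun ω p) volume
      ((k : ℝ) / n) (((k + 1 : ℕ) : ℝ) / n) := by
    refine IntervalIntegrable.mono_set hint ?_
    rw [uIcc_of_le (hle k), uIcc_of_le zero_le_one]
    exact Icc_subset_Icc (hk0 k) (hk1 hk)
  have hsum := intervalIntegral.sum_integral_adjacent_intervals (a := fun k : ℕ => (k : ℝ) / n)
    hint'
  rw [curveIntegral_def]
  simp only [Nat.cast_zero, zero_div, div_self hnR.ne'] at hsum
  rw [← hsum]
  refine Finset.sum_congr rfl fun k hk => ?_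
  have hkn := Finset.mem_range.1 hk
  obtain ⟨c, r, hcr, hq⟩ := hball (gridPoint n k)
  have hω := h.mono hcr
  have hmem : ∀ t ∈ Icc ((k : ℝ) / n) (((k + 1 : ℕ) : ℝ) / n), p.extend t ∈ Metric.ball c r := by
    intro t ht
    refine hq (projIcc 0 1 zero_le_one t) (lt_of_le_of_lt ?_ hn)
    rw [Subtype.dist_eq, Real.dist_eq]
    refine (abs_projIcc_sub_projIcc zero_le_one).trans ?_
    rw [abs_of_nonneg (sub_nonneg.2 ht.1)]
    refine (sub_le_sub_right ht.2 _).trans (le_of_eq ?_)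
    rw [← sub_div, Nat.cast_succ, add_sub_cancel_left]
  set x := p.extend ((k : ℝ) / n) with hx
  have hxc : x ∈ Metric.ball c r := hmem _ (left_mem_Icc.2 (hle k))
  have hΦ : ∀ t ∈ Icc ((k : ℝ) / n) (((k + 1 : ℕ) : ℝ) / n),
      HasFDerivAt (fun y => curveIntegral ω (.segment x y)) (ω (p.extend t)) (p.extend t) :=
    fun t ht => hω.hasFDerivAt_segment (convex_ball c r) Metric.isOpen_ball hxc (hmem t ht)
  have hftc := integral_eq_of_hasDerivAt_off_countable_of_le
    (fun t => curveIntegral ω (.segment x (p.extend t))) (curveIntegralFun ω p) (hle k)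
    hs.countable
    (fun t ht => ((hΦ t ht).continuousAt.comp p.extend.continuous.continuousAt).continuousWithinAt)
    (fun t ht => ?_) (hint' k hkn)
  · rw [hftc, ← hx, curveIntegral_segment_self, sub_zero]
    rfl
  · have ht0 : 0 < t := (hk0 k).trans_lt ht.1.1
    have ht1 : t < 1 := ht.1.2.trans_le (hk1 hkn)
    rw [curveIntegralFun_def, derivWithin_of_mem_nhds (Icc_mem_nhds ht0 ht1)]
    exact (hΦ t (Ioo_subset_Icc_self ht.1)).comp_hasDerivAt t
      (hdiff t ⟨⟨ht0, ht1⟩, ht.2⟩).hasDerivAt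

theorem PiecewiseC1.symm (hp : PiecewiseC1 p) : PiecewiseC1 p.symm := by
  obtain ⟨n, part, hmono, h0, h1, hC⟩ := hp
  refine ⟨n, fun i => 1 - part (n - i), fun i j hij => ?_, by simp [h1], by simp [h0],
    fun i hi => ?_⟩
  · exact sub_le_sub_left (hmono (Nat.sub_le_sub_left hij n)) 1
  · rw [p.extend_symm]
    refine (hC (n - (i + 1)) (by omega)).comp (by fun_prop) fun t ht => ?_
    rw [show n - (i + 1) + 1 = n - i by omega]
    constructor <;> linarith [ht.1, ht.2]

theorem PiecewiseC1.trans (hp : PiecewiseC1 p) (hq : PiecewiseC1 q) : PiecewiseC1 (p.trans q) := by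
  obtain ⟨n, u, hu, hu0, hu1, hC⟩ := hp
  obtain ⟨m, v, hv, hv0, hv1, hD⟩ := hq
  refine ⟨n + m, fun i => if i ≤ n then u i / 2 else (1 + v (i - n)) / 2,
    monotone_nat_of_le_succ fun i => ?_, by simp [hu0], ?_, fun i hi => ?_⟩
  · split_ifs with h h' h'
    · linarith [hu i.le_succ]
    · have := hu h
      have := hv (i + 1 - n).zero_le
      linarith
    · omega
    · have := hv (show i - n ≤ i + 1 - n by omega)
      linarith
  · by_cases hm : m = 0
    · rw [hm, hv0] at hv1
      exact absurd hv1 zero_ne_one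
    · beta_reduce
      rw [if_neg (by omega), Nat.add_sub_cancel_left, hv1]
      norm_num
  · by_cases h : i < n
    · simp only [if_pos h.le, if_pos (Nat.succ_le_of_lt h)]
      have h1 : u (i + 1) ≤ 1 := hu1 ▸ hu h
      have hcomp : ContDiffOn ℝ 1 (fun t : ℝ => p.extend (2 * t)) (Icc (u i / 2) (u (i + 1) / 2)) :=
        (hC i h).comp (by fun_prop) fun t ht => by constructor <;> linarith [ht.1, ht.2]
      exact hcomp.congr fun t ht => p.extend_trans_of_le_half q (by linarith [ht.2])
    · -- the breakpoint `u n / 2 = 1 / 2` is also `(1 + v 0) / 2`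
      have hi' : (if i ≤ n then u i / 2 else (1 + v (i - n)) / 2) = (1 + v (i - n)) / 2 := by
        split_ifs with h'
        · rw [le_antisymm h' (not_lt.1 h), hu1, Nat.sub_self, hv0, add_zero]
        · rfl
      simp only [hi', if_neg (show ¬ i + 1 ≤ n by omega), show i + 1 - n = i - n + 1 by omega]
      have h0 : 0 ≤ v (i - n) := hv0 ▸ hv (i - n).zero_le
      have hcomp : ContDiffOn ℝ 1 (fun t : ℝ => q.extend (2 * t - 1))
          (Icc ((1 + v (i - n)) / 2) ((1 + v (i - n + 1)) / 2)) :=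
        (hD (i - n) (by omega)).comp (by fun_prop) fun t ht => by
          constructor <;> linarith [ht.1, ht.2]
      exact hcomp.congr fun t ht => p.extend_trans_of_half_le q (by linarith [ht.1])

end PiecewisePath

/-! ### Loops spanned by a surface -/

section Spans

variable {X : Type*} [TopologicalSpace X] {U : Set X} {a : X} {Γ : Path a a}

theorem Spans.mono {V : Set X} (h : Spans U Γ) (hUV : U ⊆ V) : Spans V Γ := by
  obtain ⟨c, hc, hΓ⟩ := h
  exact ⟨c, fun T hT => (hc T hT).trans hUV, hΓ⟩

/-- Since the boundary of the surface is exactly `Γ`, the loop itself is an edge of a triangle of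
the surface. -/
theorem Spans.range_subset (h : Spans U Γ) : range Γ ⊆ U := by
  classical
  obtain ⟨c, hc, hΓ⟩ := h
  -- the path occurs in the boundary chain, so it is an edge of one of the triangles
  have hmem : Γ.toContinuousMap ∈ (triangleBoundary c).support := by
    rw [hΓ]
    simp
  rw [triangleBoundary, Finsupp.sum] at hmem
  obtain ⟨T, hT, hmem⟩ := Finset.mem_biUnion.1 (Finsupp.support_finsetSum hmem)
  have hedge : ∃ i j, Γ.toContinuousMap = T.comp (triangleEdge i j) := by
    by_contra! hne
    refine Finsupp.mem_support_iff.1 hmem ?_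
    simp [(hne _ _).symm]
  obtain ⟨i, j, hij⟩ := hedge
  rintro _ ⟨r, rfl⟩
  exact hc T hT ⟨triangleEdge i j r, (DFunLike.congr_fun hij r).symm⟩

end Spans

section Stokes

variable {E F : Type*} [NormedAddCommGroup E] [NormedSpace ℝ E] [NormedAddCommGroup F]
  [NormedSpace ℝ F] {ω : E → E →L[ℝ] F} {U : Set E} {a : E} {Γ : Path a a}

/-- A closed 1-form has integral zero along a loop that bounds a singular 2-chain. -/
theorem IsClosedFormOn.curveIntegral_eq_zero_of_spans [CompleteSpace F] (h : IsClosedFormOn ω U)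
    (hU : IsOpen U) (hΓ : PiecewiseC1 Γ) (hs : Spans U Γ) : curveIntegral ω Γ = 0 := by
  have hrange := hs.range_subset
  obtain ⟨c, hc, hcΓ⟩ := hs
  obtain ⟨n, hn, hn'⟩ := ((h.eventually_polygonalSum_triangleBoundary hU c hc).and
    (h.eventually_polygonalSum_eq_curveIntegral hU hΓ hrange)).exists
  rwa [hcΓ, Finsupp.linearCombination_single, one_smul, hn'] at hn

end Stokes

/-! ### The form `f(u) du` of an analytic function -/

namespace Fourcomplex

variable {s : FourSystem}

/-- The product of the system as a continuous bilinear map. -/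
noncomputable def mulCLM (s : FourSystem) : Fourcomplex s →L[ℝ] Fourcomplex s →L[ℝ] Fourcomplex s :=
  LinearMap.toContinuousLinearMap
    (LinearMap.toContinuousLinearMap.toLinearMap ∘ₗ LinearMap.mul ℝ (Fourcomplex s))

theorem HasFourDerivAt.hasFDerivAt {f : Fourcomplex s → Fourcomplex s} {f' u : Fourcomplex s}
    (h : HasFourDerivAt f f' u) : HasFDerivAt f (mulCLM s f') u :=
  .of_isLittleO h

/-- The form `f(u) du` has derivative `(v, w) ↦ f'(u) v w`, symmetric since the product is
commutative and associative. -/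
theorem isClosedFormOn_form (f : Fourcomplex s → Fourcomplex s) :
    IsClosedFormOn (form f) {u | IsAnalyticAt f u} := by
  intro u hu
  obtain ⟨f', hf'⟩ := hu.self_of_nhds
  -- `form f` is definitionally `fun u => mulCLM s (f u)`
  have hform : HasFDerivAt (form f) (mulCLM s ∘L mulCLM s f') u :=
    (mulCLM s).hasFDerivAt.comp u hf'.hasFDerivAt
  refine ⟨hform.differentiableAt, fun v w => ?_⟩
  rw [hform.fderiv]
  change f' * v * w = f' * w * v
  exact mul_right_comm f' v w

theorem isOpen_setOf_isAnalyticAt (f : Fourcomplex s → Fourcomplex s) :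
    IsOpen {u | IsAnalyticAt f u} :=
  isOpen_setOfPred_eventually_nhds

end Fourcomplex

/-! ### Vanishing and path independence of the fourcomplex integral -/

theorem mainTheorem7 (s : FourSystem) (f : Fourcomplex s → Fourcomplex s)
    (D J : Set (Fourcomplex s))
    (hf : ∀ u ∈ D, u ∉ Fourcomplex.singularHyperplanes J → Fourcomplex.IsAnalyticAt f u) :
    (∀ (A : Fourcomplex s) (Γ : Path A A) (S : Set (Fourcomplex s)),
      PiecewiseC1 Γ → Spans S Γ → S ⊆ D → Disjoint S (Fourcomplex.singularHyperplanes J) →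
        CurveIntegrable (Fourcomplex.form f) Γ ∧
          curveIntegral (Fourcomplex.form f) Γ = 0) ∧
    (∀ (A B : Fourcomplex s) (p q : Path A B) (S : Set (Fourcomplex s)),
      PiecewiseC1 p → PiecewiseC1 q → Spans S (p.trans q.symm) → S ⊆ D →
        Disjoint S (Fourcomplex.singularHyperplanes J) →
        CurveIntegrable (Fourcomplex.form f) p ∧ CurveIntegrable (Fourcomplex.form f) q ∧
          curveIntegral (Fourcomplex.form f) p = curveIntegral (Fourcomplex.form f) q) := by
  have hU := Fourcomplex.isOpen_setOf_isAnalyticAt f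
  have hω := Fourcomplex.isClosedFormOn_form f
  have hsub {S : Set (Fourcomplex s)} (hSD : S ⊆ D)
      (hSJ : Disjoint S (Fourcomplex.singularHyperplanes J)) :
      S ⊆ {u | Fourcomplex.IsAnalyticAt f u} :=
    fun u hu => hf u (hSD hu) (Set.disjoint_left.1 hSJ hu)
  refine ⟨fun A Γ S hΓ hS hSD hSJ => ?_, fun A B p q S hp hq hS hSD hSJ => ?_⟩
  · have hS' := hS.mono (hsub hSD hSJ)
    exact ⟨hΓ.curveIntegrable hω.continuousOn hS'.range_subset,
      hω.curveIntegral_eq_zero_of_spans hU hΓ hS'⟩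
  · have hS' := hS.mono (hsub hSD hSJ)
    have hrange := hS'.range_subset
    rw [Path.trans_range, Path.symm_range, Set.union_subset_iff] at hrange
    have hpi := hp.curveIntegrable hω.continuousOn hrange.1
    have hqi := hq.curveIntegrable hω.continuousOn hrange.2
    have hzero := hω.curveIntegral_eq_zero_of_spans hU (hp.trans hq.symm) hS'
    rw [curveIntegral_trans hpi hqi.symm, curveIntegral_symm] at hzero
    exact ⟨hpi, hqi, add_neg_eq_zero.1 hzero⟩
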